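/- Let $S$ be a completely simple semigroup (that is, $S$ has a primitive idempotent and no proper two-sided ideals) with maximal subgroups isomorphic to a group $G$, and let $\tau : Y^+ \to S$ be a surjective morphism from the free semigroup on a finite alphabet $Y$, so that $S$ is finitely generated. Write $\hat Y = Y \cup \{\bar y : y \in Y\}$ with $\bar y$ formal inverses, let $S^1$ be $S$ with a new identity $1$ adjoined (even if $S$ already has one), and let the loop problem $L_\tau(S) \subseteq \hat Y^*$ be the set of words labelling paths from $1$ to $1$ in the right Cayley graph of $S^1$ with respect to $\tau$, to which an edge from $b$ to $a$ labelled $\bar y$ has been added for every edge from $a$ to $b$ labelled $y$. For a surjective morphism $\sigma : X^* \to G$ let $W_\sigma(G) = \{ w \in X^* : w\sigma = 1\}$ be the word problem. A rational transduction from $X$ to $\hat Y$ is a relation $\rho \subseteq X^* \times \hat Y^*$ accepted by a finite transducer (a finite directed graph with edges labelled by elements of $X^* \times \hat Y^*$, an initial vertex and a set of terminal vertices), and $L\rho = \{ v : (u,v) \in \rho \text{ for some } u \in L\}$. The Kleene closure $K^*$ of a language $K$ is the submonoid it generates. Then: 1. $G$ is finitely generated. 2. For every finite alphabet $X$ and every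 surjective morphism $\sigma : X^* \to G$ there is a rational transduction $\rho$ from $X$ to $\hat Y$ with $L_\tau(S) = (W_\sigma(G)\,\rho)^*$. 3. There are finite sets $I, J$ and a $J \times I$ matrix $P$ over $G$ such that $S$ is isomorphic to the Rees matrix semigroup $M(G;I,J;P)$, that is, to $I \times G \times J$ with multiplication $(i,g,j)(k,h,l) = (i, g P_{jk} h, l)$. 4. The transduction may be taken explicitly as follows. Let $\sigma : X^* \to G$ be as in 2, let $I, J$ be sets, let $P$ be a $J\times I$ matrix over $G$, and let $\varphi : S \to M(G;I,J;P)$ be an isomorphism. Write $(y\tau)\varphi = (i_y, g_y, j_y)$ for $y \in Y$, and let $w_y, w_y', w_{ji}, w_{ji}' \in X^*$ be any words representing $g_y$, $g_y^{-1}$, $P_{ji}$, $P_{ji}^{-1}$ respectively. Then the transducer from $X$ to $\hat Y$ with vertex set $(I \times J) \cup \{A, Z\}$, initial vertex $A$, only terminal vertex $Z$, and, for all $y \in Y$, $i \in I$, $k \in J$, the edges $$A \xrightarrow{(w_y,\,y)} (i_y,j_y), \qquad (i_y,j_y) \xrightarrow{(w_y',\,\bar y)} Z,$$ $$(i,k)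 \xrightarrow{(w_{k i_y} w_y,\,y)} (i,j_y), \qquad (i,j_y) \xrightarrow{(w_y' w_{k i_y}',\,\bar y)} (i,k),$$ is finite, and the relation $\rho$ that it accepts satisfies $L_\tau(S) = (W_\sigma(G)\,\rho)^*$. -/

import Mathlib

/-! ### Completely simple semigroups, subgroups, Rees matrix semigroups -/

/-- `z` is a zero element of `S`. -/
def IsSemigroupZero {S : Type*} [Mul S] (z : S) : Prop :=
  ∀ s : S, z * s = z ∧ s * z = z

/-- A primitive idempotent: an idempotent `e` such that every non-zero idempotent `f` with
`e f = f e = f` equals `e`. -/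
def IsPrimitiveIdempotent {S : Type*} [Mul S] (e : S) : Prop :=
  e * e = e ∧
    ∀ f : S, f * f = f → ¬ IsSemigroupZero f → e * f = f → f * e = f → e = f

/-- A (two-sided) ideal of a semigroup: a non-empty subset `A` with `S A ⊆ A` and `A S ⊆ A`. -/
def IsSemigroupIdeal {S : Type*} [Mul S] (A : Set S) : Prop :=
  A.Nonempty ∧ ∀ a ∈ A, ∀ s : S, s * a ∈ A ∧ a * s ∈ A

/-- A semigroup is completely simple if it has a primitive idempotent and no proper ideals. -/
def IsCompletelySimple (S : Type*) [Semigroup S] : Prop :=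
  (∃ e : S, IsPrimitiveIdempotent e) ∧
    ∀ A : Set S, IsSemigroupIdeal A → A = Set.univ

/-- The subsemigroup `H` is a group under the multiplication inherited from `S`. -/
def IsSubgroupOfSemigroup {S : Type*} [Semigroup S] (H : Subsemigroup S) : Prop :=
  ∃ e ∈ H, (∀ x ∈ H, e * x = x ∧ x * e = x) ∧
    ∀ x ∈ H, ∃ y ∈ H, x * y = e ∧ y * x = e

/-- A subgroup of a semigroup that is not properly contained in another subgroup. -/
def IsMaximalSubgroup {S : Type*} [Semigroup S] (H : Subsemigroup S) : Prop :=
  IsSubgroupOfSemigroup H ∧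
    ∀ K : Subsemigroup S, IsSubgroupOfSemigroup K → H ≤ K → K = H

/-- The elements `(row, entry, col)` of the Rees matrix semigroup `M(G; I, J; P)`. -/
@[ext]
structure ReesMatrix {G : Type*} [Group G] {I J : Type*} (P : J → I → G) where
  row : I
  entry : G
  col : J

/-- `(i, g, j) (k, h, l) = (i, g P_{jk} h, l)`. -/
instance ReesMatrix.instSemigroup {G : Type*} [Group G] {I J : Type*} (P : J → I → G) :
    Semigroup (ReesMatrix P) where
  mul a b := ⟨a.row, a.entry * P a.col b.row * b.entry, b.col⟩
  mul_assoc a b c := by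
    show (⟨_, _, _⟩ : ReesMatrix P) = ⟨_, _, _⟩
    simp only [HMul.hMul, ReesMatrix.mk.injEq, true_and, and_true]
    show a.entry * P a.col b.row * b.entry * P b.col c.row * c.entry
      = a.entry * P a.col b.row * (b.entry * P b.col c.row * c.entry)
    simp only [mul_assoc]

/-! ### Automata and transducers -/

/-- A directed graph on the vertex set `Q` with edges labelled by elements of a monoid `M`, an
initial vertex and a set of terminal vertices. For `M = X*` this is an automaton over `X`, and for
`M = X* × Y*` it is a transducer from `X` to `Y`. It may be infinite. -/
structure LabelledAutomaton (M : Type*) (Q : Type*) where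
  edges : Set (Q × M × Q)
  start : Q
  terminal : Set Q

namespace LabelledAutomaton

variable {M Q : Type*}

/-- `A.HasPath p m q`: there is a path from `p` to `q` labelled `m`, the label of a path being the
product of the labels of its edges. -/
inductive HasPath [Monoid M] (A : LabelledAutomaton M Q) : Q → M → Q → Prop
  | nil (q : Q) : HasPath A q 1 q
  | cons {p q r : Q} {m n : M} (h : (p, m, q) ∈ A.edges) (t : HasPath A q n r) :
      HasPath A p (m * n) r

/-- The labels of paths from the initial vertex to a terminal vertex. -/
def accepted [Monoid M] (A : LabelledAutomaton M Q) : Set M :=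
  {m | ∃ q ∈ A.terminal, A.HasPath A.start m q}

/-- The vertex and edge sets are finite. -/
def IsFinite (A : LabelledAutomaton M Q) : Prop :=
  Finite Q ∧ A.edges.Finite

end LabelledAutomaton

/-- A transducer from `X` to `Y` with state set `Q`. -/
abbrev Transducer (X Y Q : Type*) := LabelledAutomaton (FreeMonoid X × FreeMonoid Y) Q

/-- A relation `ρ ⊆ X* × Y*` is a rational transduction if it is accepted by a finite
transducer. -/
def IsRationalTransduction {X Y : Type*} (ρ : Set (FreeMonoid X × FreeMonoid Y)) : Prop :=
  ∃ (Q : Type) (T : Transducer X Y Q), T.IsFinite ∧ T.accepted = ρ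

/-- The image `L ρ` of a language `L ⊆ X*` under a relation `ρ ⊆ X* × Y*`. -/
def transductionImage {X Y : Type*} (L : Set (FreeMonoid X))
    (ρ : Set (FreeMonoid X × FreeMonoid Y)) : Set (FreeMonoid Y) :=
  {v | ∃ u ∈ L, (u, v) ∈ ρ}

/-- The Kleene closure of a language: the submonoid of the free monoid generated by it. -/
def kleeneClosure {X : Type*} (L : Set (FreeMonoid X)) : Set (FreeMonoid X) :=
  (Submonoid.closure L : Set (FreeMonoid X))

/-! ### Word problems and loop problems -/

/-- The word problem of a group `G` with respect to `σ : X* → G`. -/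
def wordProblem {X G : Type*} [Group G] (σ : FreeMonoid X →* G) : Set (FreeMonoid X) :=
  {w | σ w = 1}

/-- The loop automaton of a monoid `M` with respect to `σ : X* → M`: the right Cayley graph together
with an inverse edge, labelled by the formal inverse `x̄`, for each edge labelled `x`. The alphabet
`X̂` is `X ⊕ X`, where `inl x` stands for `x` and `inr x` for `x̄`. -/
def loopAutomaton {X M : Type*} [Monoid M] (σ : FreeMonoid X →* M) :
    LabelledAutomaton (FreeMonoid (X ⊕ X)) M where
  edges :=
    {e | ∃ (a : M) (x : X),
      e = (a, FreeMonoid.of (Sum.inl x), a * σ (FreeMonoid.of x)) ∨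
      e = (a * σ (FreeMonoid.of x), FreeMonoid.of (Sum.inr x), a)}
  start := 1
  terminal := {1}

/-- The loop problem of a monoid with respect to a choice of monoid generators. -/
def monoidLoopProblem {X M : Type*} [Monoid M] (σ : FreeMonoid X →* M) :
    Set (FreeMonoid (X ⊕ X)) :=
  (loopAutomaton σ).accepted

/-- The extension `τ¹ : Y* → S¹` of `τ : Y⁺ → S`, where `S¹ = WithOne S` is `S` with a new identity
adjoined (even if `S` already has one). -/
def extendToOne {Y S : Type*} [Semigroup S] (τ : FreeSemigroup Y →ₙ* S) :
    FreeMonoid Y →* WithOne S :=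
  FreeMonoid.lift fun y => (τ (FreeSemigroup.of y) : WithOne S)

/-- The loop problem of a semigroup with respect to a choice of semigroup generators. -/
def semigroupLoopProblem {Y S : Type*} [Semigroup S] (τ : FreeSemigroup Y →ₙ* S) :
    Set (FreeMonoid (Y ⊕ Y)) :=
  monoidLoopProblem (extendToOne τ)

/-! ### The transducer of a Rees matrix presentation -/

/-- The states `(I × J) ∪ {A, Z}`. -/
inductive ReesState (I J : Type*)
  | A : ReesState I J
  | Z : ReesState I J
  | mid (i : I) (j : J) : ReesState I J

/-- The transducer from `X` to `Ŷ` built from a Rees matrix presentation. Here `row y = i_y` and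
`col y = j_y` are the coordinates of the generator `y`, and `w y`, `w' y`, `p j i`, `p' j i` are the
chosen words for the group elements `g_y`, `g_y⁻¹`, `P_{ji}`, `P_{ji}⁻¹`. -/
def reesTransducer {X Y I J : Type*} (row : Y → I) (col : Y → J) (w w' : Y → FreeMonoid X)
    (p p' : J → I → FreeMonoid X) : Transducer X (Y ⊕ Y) (ReesState I J) where
  edges :=
    {e | ∃ y : Y, e = (.A, (w y, FreeMonoid.of (Sum.inl y)), .mid (row y) (col y))} ∪
    {e | ∃ y : Y, e = (.mid (row y) (col y), (w' y, FreeMonoid.of (Sum.inr y)), .Z)} ∪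
    {e | ∃ (y : Y) (i : I) (k : J),
      e = (.mid i k, (p k (row y) * w y, FreeMonoid.of (Sum.inl y)), .mid i (col y))} ∪
    {e | ∃ (y : Y) (i : I) (k : J),
      e = (.mid i (col y), (w' y * p' k (row y), FreeMonoid.of (Sum.inr y)), .mid i k)}
  start := .A
  terminal := {.Z}

/-! In Rees coordinates right multiplication never changes the row. So once a path in the loop
automaton leaves the adjoined identity, and until it returns, only a column and a group entry vary.
The transducer keeps row and column in its state, and its input word multiplies out to the change of
the entry. Going back along `ȳ` from an element whose column is that of `y`, cancellation in `G`
leaves exactly one predecessor in `S` for each column `k`, hence one transducer edge for each `k`.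
Going back to `1` is possible only from the generator itself, which is why the row is remembered.
Loops meeting `1` only at their ends therefore match runs from `A` to `Z` whose input represents `1`
in `G`, and every loop is a concatenation of such loops. The two directions are
`splits_of_loop_hasPath` and `loop_hasPath_of_hasPath`. Coordinates come from the Rees theorem
(`IsCompletelySimple.exists_rees`): a maximal subgroup is `eSe` for its identity `e`, and absence of
proper ideals writes every element as `u e v`. Finite generation of `S` bounds rows and columns and
passes to `G`. -/

open LabelledAutomaton

namespace ReesMatrix

variable {G : Type*} [Group G] {I J : Type*} {P : J → I → G}

@[simp] theorem mul_row (a b : ReesMatrix P) : (a * b).row = a.row := rfl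

@[simp] theorem mul_col (a b : ReesMatrix P) : (a * b).col = b.col := rfl

@[simp] theorem mul_entry (a b : ReesMatrix P) :
    (a * b).entry = a.entry * P a.col b.row * b.entry := rfl

/-- Reindexing the rows and columns of a Rees matrix semigroup. -/
def reindex {I' J' : Type*} (f : I ≃ I') (g : J ≃ J') (P : J → I → G) :
    ReesMatrix P ≃* ReesMatrix (fun j i => P (g.symm j) (f.symm i)) where
  toFun a := ⟨f a.row, a.entry, g a.col⟩
  invFun a := ⟨f.symm a.row, a.entry, g.symm a.col⟩
  left_inv a := by ext <;> simp
  right_inv a := by ext <;> simp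
  map_mul' a b := by ext <;> simp

end ReesMatrix

/-! ### Finiteness inherited from a finite generating set. -/

section Generation

variable {S G Y I J : Type*} [Semigroup S] [Group G] {P : J → I → G}
  {τ : FreeSemigroup Y →ₙ* S}

/-- Induction on products of generators from the left. -/
theorem induction_of_surjective (hτ : Function.Surjective τ) {C : S → Prop}
    (of : ∀ y, C (τ (FreeSemigroup.of y)))
    (mul : ∀ y s, C s → C (τ (FreeSemigroup.of y) * s)) (s : S) : C s := by
  obtain ⟨t, rfl⟩ := hτ s
  induction t using FreeSemigroup.recOnMul with
  | ih1 y => exact of y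
  | ih2 y t _ ht => rw [map_mul]; exact mul y _ ht

/-- A product has the row of its first factor; dually, it has the column of its last. -/
theorem exists_row_eq (hτ : Function.Surjective τ) (φ : S ≃* ReesMatrix P) (s : S) :
    ∃ y, (φ (τ (FreeSemigroup.of y))).row = (φ s).row :=
  induction_of_surjective hτ (C := fun s => ∃ y, (φ (τ (FreeSemigroup.of y))).row = (φ s).row)
    (fun y => ⟨y, rfl⟩) (fun y s _ => ⟨y, by simp⟩) s

theorem exists_col_eq (hτ : Function.Surjective τ) (φ : S ≃* ReesMatrix P) (s : S) :
    ∃ y, (φ (τ (FreeSemigroup.of y))).col = (φ s).col :=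
  induction_of_surjective hτ (C := fun s => ∃ y, (φ (τ (FreeSemigroup.of y))).col = (φ s).col)
    (fun y => ⟨y, rfl⟩) (fun y s ⟨z, hz⟩ => ⟨z, by simpa using hz⟩) s

theorem finite_rows [Nonempty S] [Finite Y] (hτ : Function.Surjective τ)
    (φ : S ≃* ReesMatrix P) : Finite I := by
  obtain ⟨s⟩ := ‹Nonempty S›
  refine Finite.of_surjective (fun y => (φ (τ (FreeSemigroup.of y))).row) fun i => ?_
  simpa using exists_row_eq hτ φ (φ.symm ⟨i, 1, (φ s).col⟩)

theorem finite_cols [Nonempty S] [Finite Y] (hτ : Function.Surjective τ)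
    (φ : S ≃* ReesMatrix P) : Finite J := by
  obtain ⟨s⟩ := ‹Nonempty S›
  refine Finite.of_surjective (fun y => (φ (τ (FreeSemigroup.of y))).col) fun j => ?_
  simpa using exists_col_eq hτ φ (φ.symm ⟨(φ s).row, 1, j⟩)

/-- The structure group of a finitely generated Rees matrix semigroup is finitely generated. -/
theorem groupFG_of_rees [Nonempty S] [Finite Y] (hτ : Function.Surjective τ)
    (φ : S ≃* ReesMatrix P) : Group.FG G := by
  have := finite_rows hτ φ
  have := finite_cols hτ φ
  -- Multiplying out generators produces only their entries and sandwich matrix entries, and every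
  -- `g` is the entry of some element.
  let A : Set G := Set.range (fun y => (φ (τ (FreeSemigroup.of y))).entry) ∪
    Set.range (fun x : J × I => P x.1 x.2)
  have hy (y) : (φ (τ (FreeSemigroup.of y))).entry ∈ Subgroup.closure A :=
    Subgroup.subset_closure (Or.inl ⟨y, rfl⟩)
  have hP (j i) : P j i ∈ Subgroup.closure A := Subgroup.subset_closure (Or.inr ⟨(j, i), rfl⟩)
  have key : ∀ s, (φ s).entry ∈ Subgroup.closure A := induction_of_surjective hτ hy fun y s hs => by
    rw [map_mul, ReesMatrix.mul_entry]
    exact mul_mem (mul_mem (hy y) (hP _ _)) hs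
  obtain ⟨s⟩ := ‹Nonempty S›
  refine Group.fg_iff.2 ⟨A, top_unique fun g _ => ?_, (Set.finite_range _).union (Set.finite_range _)⟩
  simpa using key (φ.symm ⟨(φ s).row, g, (φ s).col⟩)

end Generation

/-! ### The Rees theorem for completely simple semigroups. -/

section ReesTheorem

variable {S : Type*} [Semigroup S]

/-- In a semigroup without proper ideals every element is a multiple of every other one. -/
theorem exists_eq_mul_mul (hS : ∀ A : Set S, IsSemigroupIdeal A → A = Set.univ) (a s : S) :
    ∃ u v, s = u * a * v := by
  have h := hS {t | ∃ u v, t = u * a * v} ⟨⟨a * a * a, a, a, rfl⟩, by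
    rintro _ ⟨u, v, rfl⟩ t
    exact ⟨⟨t * u, v, by simp only [mul_assoc]⟩, ⟨u, v * t, by simp only [mul_assoc]⟩⟩⟩
  exact h.ge (Set.mem_univ s)

/-- The local monoid `e S e` of the idempotent `e` is a group: its elements have right inverses
in it. -/
def IsLocalGroup (e : S) : Prop :=
  e * e = e ∧ ∀ a, e * a = a → a * e = a → ∃ b, e * b = b ∧ b * e = b ∧ a * b = e

theorem IsLocalGroup.exists_inv {e : S} (he : IsLocalGroup e) {a : S} (h₁ : e * a = a)
    (h₂ : a * e = a) : ∃ b, e * b = b ∧ b * e = b ∧ a * b = e ∧ b * a = e := by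
  obtain ⟨b, b₁, b₂, hab⟩ := he.2 a h₁ h₂
  obtain ⟨c, c₁, c₂, hbc⟩ := he.2 b b₁ b₂
  have : a = c := by rw [← h₂, ← hbc, ← mul_assoc, hab, c₁]
  exact ⟨b, b₁, b₂, hab, by rw [this, hbc]⟩

/-- Expressing a local identity as a multiple of a local element, with local factors. -/
theorem exists_absorbing_factors (hS : ∀ A : Set S, IsSemigroupIdeal A → A = Set.univ)
    {e a f : S} (hf : f * f = f) (he : e * e = e) (h₁ : e * a = a) (h₂ : a * e = a) :
    ∃ x y, f = x * a * y ∧ f * x = x ∧ x * e = x ∧ e * y = y ∧ y * f = y := by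
  obtain ⟨u, v, h⟩ := exists_eq_mul_mul hS a f
  refine ⟨f * u * e, e * v * f, ?_, ?_, ?_, ?_, ?_⟩
  · calc f = f * f * f := by rw [hf, hf]
      _ = f * (u * a * v) * f := by rw [← h]
      _ = f * (u * (e * a * e) * v) * f := by rw [h₁, h₂]
      _ = f * u * e * a * (e * v * f) := by simp only [mul_assoc]
  · simp only [← mul_assoc, hf]
  · simp only [mul_assoc, he]
  · simp only [← mul_assoc, he]
  · simp only [mul_assoc, hf]

/-- With `f = x a y`, the element `a y x` is an idempotent below `f`, so primitivity forces it to be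
`f`. If it were a zero, it would form an ideal by itself and `S` would be trivial. -/
theorem IsPrimitiveIdempotent.isLocalGroup
    (hS : ∀ A : Set S, IsSemigroupIdeal A → A = Set.univ) {f : S}
    (hf : IsPrimitiveIdempotent f) : IsLocalGroup f := by
  refine ⟨hf.1, fun a h₁ h₂ => ?_⟩
  obtain ⟨x, y, h, hx₁, hx₂, hy₁, hy₂⟩ := exists_absorbing_factors hS hf.1 hf.1 h₁ h₂
  refine ⟨y * x, by rw [← mul_assoc, hy₁], by rw [mul_assoc, hx₂], ?_⟩
  by_cases hz : IsSemigroupZero (a * (y * x))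
  · have := hS {a * (y * x)} ⟨⟨_, rfl⟩, by
      rintro _ rfl s
      exact ⟨(hz s).2, (hz s).1⟩⟩
    exact (this.ge (Set.mem_univ f)).symm
  · refine (hf.2 _ ?_ hz ?_ ?_).symm
    · calc a * (y * x) * (a * (y * x)) = a * y * (x * a * y) * x := by simp only [mul_assoc]
        _ = a * (y * x) := by rw [← h, mul_assoc a, hy₂, mul_assoc]
    · rw [← mul_assoc, h₁]
    · rw [mul_assoc, mul_assoc, hx₂]

/-- In a semigroup without proper ideals, if one idempotent is the identity of a local group, so
is every other one. -/
theorem IsLocalGroup.of_idempotent (hS : ∀ A : Set S, IsSemigroupIdeal A → A = Set.univ)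
    {f e : S} (hf : IsLocalGroup f) (he : e * e = e) : IsLocalGroup e := by
  -- After simplification `f = x y` and `e = u v`. Inverting `x u` in `fSf` gives also `e = y x`, so
  -- `a ↦ x a y` carries `eSe` to `fSf`, and `b ↦ y b x` carries inverses back.
  obtain ⟨x, y, h, hx₁, hx₂, hy₁, hy₂⟩ := exists_absorbing_factors hS hf.1 he he he
  obtain ⟨u, v, h', hu₁, hu₂, hv₁, hv₂⟩ := exists_absorbing_factors hS he hf.1 hf.1 hf.1
  rw [hx₂] at h
  rw [hu₂] at h'
  obtain ⟨b, b₁, b₂, hab, hba⟩ := hf.exists_inv (a := x * u) (by rw [← mul_assoc, hx₁])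
    (by rw [mul_assoc, hu₂])
  have hb : b = v * y := by
    calc b = b * (x * (u * v) * y) := by rw [← h', hx₂, ← h, b₂]
      _ = b * (x * u) * (v * y) := by simp only [mul_assoc]
      _ = v * y := by rw [hba, ← mul_assoc, hv₁]
  have hyx : e = y * x := by
    calc e = u * f * v := by rw [hu₂, h']
      _ = u * (b * (x * u)) * v := by rw [hba]
      _ = (u * v) * y * x * (u * v) := by rw [hb]; simp only [mul_assoc]
      _ = y * x := by rw [← h', hy₁, mul_assoc, hx₂]
  refine ⟨he, fun a h₁ h₂ => ?_⟩
  obtain ⟨b, b₁, b₂, hab⟩ := hf.2 (x * a * y) (by simp only [← mul_assoc, hx₁])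
    (by simp only [mul_assoc, hy₂])
  refine ⟨y * b * x, by simp only [← mul_assoc, hy₁], by simp only [mul_assoc, hx₂], ?_⟩
  calc a * (y * b * x) = e * a * (y * b * x) := by rw [h₁]
    _ = y * (x * a * y * b) * x := by rw [hyx]; simp only [mul_assoc]
    _ = e := by rw [hab, hy₂, hyx]

/-- A maximal subgroup of a completely simple semigroup is the local monoid at its identity. -/
theorem IsMaximalSubgroup.exists_identity (hS : IsCompletelySimple S) {H : Subsemigroup S}
    (hH : IsMaximalSubgroup H) :
    ∃ e ∈ H, (∀ x ∈ H, e * x = x ∧ x * e = x) ∧ ∀ s, e * s * e ∈ H := by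
  obtain ⟨⟨e, heH, hid, hinv⟩, hmax⟩ := hH
  obtain ⟨⟨f, hf⟩, hS⟩ := hS
  have he : e * e = e := (hid e heH).1
  have hloc := (hf.isLocalGroup hS).of_idempotent hS he
  -- `K` is `eSe`, a group containing `H`, so maximality identifies the two.
  let K : Subsemigroup S :=
    { carrier := {a | e * a = a ∧ a * e = a}
      mul_mem' := fun {a b} ha hb => ⟨by rw [← mul_assoc, ha.1], by rw [mul_assoc, hb.2]⟩ }
  have hK : K = H := hmax K ⟨e, ⟨he, he⟩, fun x hx => hx, fun x hx => by
    obtain ⟨b, b₁, b₂, h, h'⟩ := hloc.exists_inv hx.1 hx.2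
    exact ⟨b, ⟨b₁, b₂⟩, h, h'⟩⟩ hid
  refine ⟨e, heH, hid, fun s => ?_⟩
  rw [← hK]
  exact ⟨by simp only [← mul_assoc, he], by simp only [mul_assoc, he]⟩

/-- The Rees matrix coordinates determined by a group `G` embedded as a local monoid of `S`. -/
theorem exists_rees_of_embedding {G : Type*} [Group G] (ι : G →ₙ* S)
    (hinj : Function.Injective ι) (hloc : ∀ s, ∃ g, ι g = ι 1 * s * ι 1)
    (hsimple : ∀ s, ∃ u v, s = u * ι 1 * v) :
    ∃ (I J : Set S) (P : J → I → G), Nonempty (S ≃* ReesMatrix P) := by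
  have one_mul' (g) : ι 1 * ι g = ι g := by rw [← map_mul, one_mul]
  have mul_one' (g) : ι g * ι 1 = ι g := by rw [← map_mul, mul_one]
  have one_mul_a (g) (s : S) : ι 1 * (ι g * s) = ι g * s := by rw [← mul_assoc, one_mul']
  have mul_one_a (g) (s : S) : ι g * (ι 1 * s) = ι g * s := by rw [← mul_assoc, mul_one']
  have mul_inv' (g) : ι g * ι g⁻¹ = ι 1 := by rw [← map_mul, mul_inv_cancel]
  have inv_mul' (g) : ι g⁻¹ * ι g = ι 1 := by rw [← map_mul, inv_mul_cancel]
  choose γ hγ using hloc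
  have hγ_mul (s t) : γ (s * ι 1 * t) = γ s * γ t := hinj <| by
    rw [map_mul, hγ, hγ, hγ]; simp only [mul_assoc, one_mul_a]
  -- With `s = u e v`, the inverse of `γ s` cancels the inner factors `e v` and `u e`.
  have regular (s) : s * ι (γ s)⁻¹ * s = s := by
    obtain ⟨u, v, rfl⟩ := hsimple s
    have hu : ι (γ u)⁻¹ * u * ι 1 = ι 1 := by
      calc ι (γ u)⁻¹ * u * ι 1 = ι (γ u)⁻¹ * (ι 1 * u * ι 1) := by
            simp only [mul_assoc, mul_one_a]
        _ = ι 1 := by rw [← hγ, inv_mul']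
    have hv : ι 1 * v * ι (γ v)⁻¹ = ι 1 := by
      calc ι 1 * v * ι (γ v)⁻¹ = ι 1 * v * ι 1 * ι (γ v)⁻¹ := by
            simp only [mul_assoc, one_mul']
        _ = ι 1 := by rw [← hγ, mul_inv']
    rw [hγ_mul, mul_inv_rev, map_mul]
    calc u * ι 1 * v * (ι (γ v)⁻¹ * ι (γ u)⁻¹) * (u * ι 1 * v)
        = u * (ι 1 * v * ι (γ v)⁻¹) * (ι (γ u)⁻¹ * u * ι 1) * v := by simp only [mul_assoc]
      _ = u * ι 1 * v := by rw [hu, hv, mul_assoc u, one_mul']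
  -- Rows and columns are normalised representatives: `s` factors as `(s γ(s)⁻¹) γ(s) (γ(s)⁻¹ s)`,
  -- the outer factors becoming `e` when multiplied by `e` on the inner-product side opposite to
  -- `γ(s)`.
  let I : Set S := {i | i * ι 1 = i ∧ ι 1 * i = ι 1}
  let J : Set S := {j | ι 1 * j = j ∧ j * ι 1 = ι 1}
  have hrow (s) : s * ι (γ s)⁻¹ ∈ I := by
    refine ⟨by rw [mul_assoc, mul_one'], ?_⟩
    calc ι 1 * (s * ι (γ s)⁻¹) = ι 1 * s * ι 1 * ι (γ s)⁻¹ := by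
          simp only [mul_assoc, one_mul']
      _ = ι 1 := by rw [← hγ, mul_inv']
  have hcol (s) : ι (γ s)⁻¹ * s ∈ J := by
    refine ⟨by rw [← mul_assoc, one_mul'], ?_⟩
    calc ι (γ s)⁻¹ * s * ι 1 = ι (γ s)⁻¹ * (ι 1 * s * ι 1) := by
          simp only [mul_assoc, mul_one_a]
      _ = ι 1 := by rw [← hγ, inv_mul']
  let P : J → I → G := fun j i => γ (j * i)
  have hP (j : J) (i : I) : ι (P j i) = j * i := by
    rw [hγ, ← mul_assoc, j.2.1, mul_assoc, i.2.1]
  have hentry (i : I) (g : G) (j : J) : γ (i * ι g * j) = g := hinj <| by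
    rw [hγ]
    calc ι 1 * (i * ι g * j) * ι 1 = ι 1 * i * ι g * (j * ι 1) := by simp only [mul_assoc]
      _ = ι g := by rw [i.2.2, j.2.2, one_mul', mul_one']
  let ψ : ReesMatrix P ≃* S :=
    { toFun := fun a => a.row * ι a.entry * a.col
      invFun := fun s => ⟨⟨_, hrow s⟩, γ s, ⟨_, hcol s⟩⟩
      left_inv := by
        rintro ⟨i, g, j⟩
        ext
        · show (i : S) * ι g * j * ι (γ (i * ι g * j))⁻¹ = i
          rw [hentry]
          calc (i : S) * ι g * j * ι g⁻¹ = i * ι g * (j * ι 1 * ι g⁻¹) := by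
                simp only [mul_assoc, one_mul']
            _ = i := by rw [j.2.2, one_mul', mul_assoc, mul_inv', i.2.1]
        · exact hentry i g j
        · show ι (γ (i * ι g * j))⁻¹ * ((i : S) * ι g * j) = j
          rw [hentry]
          calc ι g⁻¹ * ((i : S) * ι g * j) = ι g⁻¹ * (ι 1 * i) * ι g * j := by
                simp only [mul_assoc, mul_one_a]
            _ = j := by rw [i.2.2, mul_one', inv_mul', j.2.1]
      right_inv := fun s => by
        show s * ι (γ s)⁻¹ * ι (γ s) * (ι (γ s)⁻¹ * s) = s
        rw [mul_assoc s, inv_mul', mul_assoc s, one_mul_a, ← mul_assoc, regular]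
      map_mul' := fun a b => by
        show (a.row : S) * ι (a.entry * P a.col b.row * b.entry) * b.col = _
        rw [map_mul, map_mul, hP]
        simp only [mul_assoc] }
  exact ⟨I, J, P, ⟨ψ.symm⟩⟩

/-- The Rees theorem: a completely simple semigroup is a Rees matrix semigroup over any of its
maximal subgroups. -/
theorem IsCompletelySimple.exists_rees {G : Type*} [Group G] (hS : IsCompletelySimple S)
    (hG : ∃ H : Subsemigroup S, IsMaximalSubgroup H ∧ Nonempty (H ≃* G)) :
    ∃ (I J : Set S) (P : J → I → G), Nonempty (S ≃* ReesMatrix P) := by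
  obtain ⟨H, hH, ⟨ψ⟩⟩ := hG
  obtain ⟨e, heH, hid, hloc⟩ := hH.exists_identity hS
  let ι : G →ₙ* S := (MulMemClass.subtype H).comp (ψ.symm : G →ₙ* H)
  have hι : ι 1 = e := by
    have : ψ ⟨e, heH⟩ = 1 := by
      have h : ψ ⟨e, heH⟩ * ψ ⟨e, heH⟩ = ψ ⟨e, heH⟩ := by
        rw [← map_mul]; exact congrArg ψ (Subtype.ext (hid e heH).1)
      exact mul_eq_left.1 h
    show ((ψ.symm 1 : H) : S) = e
    rw [← this, MulEquiv.symm_apply_apply]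
  refine exists_rees_of_embedding ι (Subtype.val_injective.comp ψ.symm.injective) (fun s => ?_)
    (fun s => exists_eq_mul_mul hS.2 _ s)
  refine ⟨ψ ⟨_, hloc s⟩, ?_⟩
  rw [hι]
  show ((ψ.symm (ψ _) : H) : S) = _
  rw [MulEquiv.symm_apply_apply]

/-- Indexing by `Fin` puts the transducer states in `Type`, as `IsRationalTransduction` requires. -/
theorem IsCompletelySimple.exists_finite_rees {G : Type*} [Group G] (hS : IsCompletelySimple S)
    (hG : ∃ H : Subsemigroup S, IsMaximalSubgroup H ∧ Nonempty (H ≃* G))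
    {Y : Type*} [Finite Y] (τ : FreeSemigroup Y →ₙ* S) (hτ : Function.Surjective τ) :
    ∃ (m n : ℕ) (P : Fin n → Fin m → G), Nonempty (S ≃* ReesMatrix P) := by
  obtain ⟨I, J, P, ⟨φ⟩⟩ := hS.exists_rees hG
  have : Nonempty S := ⟨hS.1.choose⟩
  have := finite_rows hτ φ
  have := finite_cols hτ φ
  exact ⟨_, _, _, ⟨φ.trans (ReesMatrix.reindex (Finite.equivFin I) (Finite.equivFin J) P)⟩⟩

end ReesTheorem

/-! ### Concatenation of paths and finiteness of the transducer. -/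

section Paths

namespace LabelledAutomaton

variable {M Q : Type*} [Monoid M] {A : LabelledAutomaton M Q}

theorem HasPath.trans {p q r : Q} {m n : M} (h : A.HasPath p m q) (h' : A.HasPath q n r) :
    A.HasPath p (m * n) r := by
  induction h with
  | nil => simpa using h'
  | cons e _ ih => rw [mul_assoc]; exact .cons e (ih h')

end LabelledAutomaton

theorem kleeneClosure_monoidLoopProblem_le {X M : Type*} [Monoid M] (σ : FreeMonoid X →* M)
    {L : Set (FreeMonoid (X ⊕ X))} (hL : L ⊆ monoidLoopProblem σ) :
    kleeneClosure L ⊆ monoidLoopProblem σ := by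
  let N : Submonoid (FreeMonoid (X ⊕ X)) :=
    { carrier := {v | (loopAutomaton σ).HasPath 1 v 1}
      one_mem' := .nil 1
      mul_mem' := fun h h' => h.trans h' }
  have h : Submonoid.closure L ≤ N := Submonoid.closure_le.2 fun v hv => by
    obtain ⟨_, rfl, h⟩ := hL hv
    exact h
  exact fun v hv => ⟨1, rfl, h hv⟩

theorem ReesState.finite {I J : Type*} [Finite I] [Finite J] : Finite (ReesState I J) := by
  refine Finite.of_surjective
    (fun x : Option (Option (I × J)) => match x with
      | none => ReesState.A
      | some none => ReesState.Z
      | some (some (i, j)) => ReesState.mid i j) ?_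
  rintro (_ | _ | ⟨i, j⟩)
  exacts [⟨none, rfl⟩, ⟨some none, rfl⟩, ⟨some (some (i, j)), rfl⟩]

theorem reesTransducer_isFinite {X Y I J : Type*} [Finite Y] [Finite I] [Finite J] (row : Y → I)
    (col : Y → J) (w w' : Y → FreeMonoid X) (p p' : J → I → FreeMonoid X) :
    (reesTransducer row col w w' p p').IsFinite := by
  have single {β} (f : Y → β) : {e | ∃ y, e = f y}.Finite :=
    (Set.finite_range f).subset fun _ ⟨y, h⟩ => ⟨y, h.symm⟩
  have triple {β} (f : Y → I → J → β) : {e | ∃ y i k, e = f y i k}.Finite :=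
    (Set.finite_range fun x : Y × I × J => f x.1 x.2.1 x.2.2).subset
      fun _ ⟨y, i, k, h⟩ => ⟨(y, i, k), h.symm⟩
  exact ⟨ReesState.finite,
    (((single _).union (single _)).union (triple _)).union (triple _)⟩

end Paths

/-! ### Loops at the identity versus runs of the transducer. -/

section LoopProblem

variable {S G X Y I J : Type*} [Semigroup S] [Group G] {P : J → I → G}
  {τ : FreeSemigroup Y →ₙ* S} {σ : FreeMonoid X →* G} {φ : S ≃* ReesMatrix P}
  {w w' : Y → FreeMonoid X} {p p' : J → I → FreeMonoid X}

@[simp] theorem extendToOne_of (τ : FreeSemigroup Y →ₙ* S) (y : Y) :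
    extendToOne τ (FreeMonoid.of y) = (τ (FreeSemigroup.of y) : WithOne S) := by
  simp [extendToOne]

/-- The transducer attached to Rees matrix coordinates of `S`. -/
abbrev coordinateTransducer (τ : FreeSemigroup Y →ₙ* S) (φ : S ≃* ReesMatrix P)
    (w w' : Y → FreeMonoid X) (p p' : J → I → FreeMonoid X) :
    Transducer X (Y ⊕ Y) (ReesState I J) :=
  reesTransducer (fun y => (φ (τ (FreeSemigroup.of y))).row)
    (fun y => (φ (τ (FreeSemigroup.of y))).col) w w' p p'

/-- A path to `1` in the loop automaton splits, at its first visit to `1`, into a part read by the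
transducer and a part in the Kleene closure. -/
theorem splits_of_loop_hasPath
    (hw : ∀ y, σ (w y) = (φ (τ (FreeSemigroup.of y))).entry)
    (hw' : ∀ y, σ (w' y) = (φ (τ (FreeSemigroup.of y))).entry⁻¹)
    (hp : ∀ j i, σ (p j i) = P j i) (hp' : ∀ j i, σ (p' j i) = (P j i)⁻¹)
    {K : Submonoid (FreeMonoid (Y ⊕ Y))}
    (hK : transductionImage (wordProblem σ) (coordinateTransducer τ φ w w' p p').accepted ⊆ K)
    {a b : WithOne S} {v : FreeMonoid (Y ⊕ Y)}
    (h : (loopAutomaton (extendToOne τ)).HasPath a v b) (hb : b = 1) :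
    (a = 1 → v ∈ K) ∧ ∀ s : S, a = s → ∃ u v₁ v₂, v = v₁ * v₂ ∧ v₂ ∈ K ∧
      (coordinateTransducer τ φ w w' p p').HasPath (.mid (φ s).row (φ s).col) (u, v₁) .Z ∧
      σ u = (φ s).entry⁻¹ := by
  induction h with
  | nil q => exact ⟨fun _ => K.one_mem, fun s hs => absurd (hs.symm.trans hb) WithOne.coe_ne_one⟩
  | @cons _ a _ _ _ e t ih =>
    obtain ⟨ih₁, ih₂⟩ := ih hb
    obtain ⟨_, y, e | e⟩ := e
    · simp only [extendToOne_of, Prod.mk.injEq] at e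
      obtain ⟨rfl, rfl, rfl⟩ := e
      constructor
      · rintro rfl
        obtain ⟨u, v₁, v₂, rfl, hv₂, hpath, hu⟩ := ih₂ _ (one_mul _)
        rw [← mul_assoc]
        refine K.mul_mem (hK ⟨w y * u, ?_, .Z, rfl, ?_⟩) hv₂
        · show σ _ = 1
          rw [map_mul, hw, hu, mul_inv_cancel]
        · exact .cons (m := (w y, FreeMonoid.of (Sum.inl y))) (n := (u, v₁))
            (Or.inl (Or.inl (Or.inl ⟨y, rfl⟩))) hpath
      · rintro s rfl
        obtain ⟨u, v₁, v₂, rfl, hv₂, hpath, hu⟩ := ih₂ _ (WithOne.coe_mul _ _).symm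
        refine ⟨p (φ s).col (φ (τ (FreeSemigroup.of y))).row * w y * u, _, v₂,
          (mul_assoc _ _ _).symm, hv₂, .cons (m := (_, FreeMonoid.of (Sum.inl y))) (n := (u, v₁))
            (Or.inl (Or.inr ⟨y, _, _, rfl⟩)) ?_, ?_⟩
        · simpa using hpath
        · rw [map_mul, map_mul, hp, hw, hu, map_mul, ReesMatrix.mul_entry]
          group
    · simp only [extendToOne_of, Prod.mk.injEq] at e
      obtain ⟨rfl, rfl, rfl⟩ := e
      -- An edge `ȳ` ending at `1` is the first return: the run stops in `Z` and the rest of the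
      -- word lies in `K`.
      obtain rfl | ha := eq_or_ne a 1
      · rw [one_mul]
        refine ⟨fun h => absurd h WithOne.coe_ne_one, fun s hs => ?_⟩
        obtain rfl := WithOne.coe_injective hs
        refine ⟨w' y, _, _, rfl, ih₁ rfl, ?_, hw' y⟩
        have := HasPath.cons (A := coordinateTransducer τ φ w w' p p')
          (m := (w' y, FreeMonoid.of (Sum.inr y))) (Or.inl (Or.inl (Or.inr ⟨y, rfl⟩))) (.nil _)
        simpa using this
      · obtain ⟨r, rfl⟩ := WithOne.ne_one_iff_exists.1 ha
        rw [← WithOne.coe_mul]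
        refine ⟨fun h => absurd h WithOne.coe_ne_one, fun s hs => ?_⟩
        obtain rfl := WithOne.coe_injective hs
        obtain ⟨u, v₁, v₂, rfl, hv₂, hpath, hu⟩ := ih₂ _ rfl
        refine ⟨w' y * p' (φ r).col (φ (τ (FreeSemigroup.of y))).row * u, _, v₂,
          (mul_assoc _ _ _).symm, hv₂, .cons (m := (_, FreeMonoid.of (Sum.inr y))) (n := (u, v₁))
            (Or.inr ⟨y, (φ r).row, (φ r).col, ?_⟩) hpath, ?_⟩
        · simp
        · rw [map_mul, map_mul, hp', hw', hu, map_mul, ReesMatrix.mul_entry]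
          group

/-- Transducer paths to `Z` give paths to `1` in the loop automaton. -/
theorem loop_hasPath_of_hasPath
    (hw : ∀ y, σ (w y) = (φ (τ (FreeSemigroup.of y))).entry)
    (hw' : ∀ y, σ (w' y) = (φ (τ (FreeSemigroup.of y))).entry⁻¹)
    (hp : ∀ j i, σ (p j i) = P j i) (hp' : ∀ j i, σ (p' j i) = (P j i)⁻¹)
    {q r : ReesState I J} {m : FreeMonoid X × FreeMonoid (Y ⊕ Y)}
    (h : (coordinateTransducer τ φ w w' p p').HasPath q m r) (hr : r = .Z) :
    (q = .A → σ m.1 = 1 → (loopAutomaton (extendToOne τ)).HasPath 1 m.2 1) ∧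
    (q = .Z → m = 1) ∧
    ∀ s : S, q = .mid (φ s).row (φ s).col → σ m.1 = (φ s).entry⁻¹ →
      (loopAutomaton (extendToOne τ)).HasPath s m.2 1 := by
  induction h with
  | nil q => subst hr; simp
  | cons e t ih =>
    obtain ⟨-, ihZ, ihM⟩ := ih hr
    obtain ((⟨y, e⟩ | ⟨y, e⟩) | ⟨y, i, k, e⟩) | ⟨y, i, k, e⟩ := e <;>
      simp only [Prod.mk.injEq] at e <;> obtain ⟨rfl, rfl, rfl⟩ := e
    · refine ⟨fun _ hu => ?_, by simp, by simp⟩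
      rw [Prod.fst_mul, map_mul, hw] at hu
      exact .cons ⟨1, y, Or.inl (by rw [extendToOne_of, one_mul])⟩
        (ihM _ rfl (eq_inv_of_mul_eq_one_right hu))
    · refine ⟨by simp, by simp, fun s hs hu => ?_⟩
      -- No edge leaves `Z`, so the run ends here, and the input `w' y` forces the entry of `s` to
      -- be that of `y`.
      rw [ihZ rfl] at hu ⊢
      obtain rfl : s = τ (FreeSemigroup.of y) := φ.injective <| by
        simp only [ReesState.mid.injEq] at hs
        simp only [mul_one, hw', inv_inj] at hu
        exact ReesMatrix.ext hs.1.symm hu.symm hs.2.symm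
      exact .cons ⟨1, y, Or.inr (by rw [extendToOne_of, one_mul])⟩ (.nil 1)
    · refine ⟨by simp, by simp, fun s hs hu => ?_⟩
      simp only [ReesState.mid.injEq] at hs
      obtain ⟨rfl, rfl⟩ := hs
      refine .cons ⟨s, y, Or.inl (by rw [extendToOne_of, ← WithOne.coe_mul])⟩ (ihM _ (by simp) ?_)
      simp only [Prod.fst_mul, map_mul, hp, hw] at hu
      rw [map_mul, ReesMatrix.mul_entry, mul_inv_rev, mul_inv_rev, ← hu]
      group
    · refine ⟨by simp, by simp, fun s hs hu => ?_⟩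
      simp only [ReesState.mid.injEq] at hs
      obtain ⟨rfl, hs⟩ := hs
      set z := τ (FreeSemigroup.of y) with hz
      -- The unique solution of `t * z = s` with column `k`.
      let t : S := φ.symm ⟨(φ s).row, (φ s).entry * (φ z).entry⁻¹ * (P k (φ z).row)⁻¹, k⟩
      have ht : φ t = ⟨(φ s).row, (φ s).entry * (φ z).entry⁻¹ * (P k (φ z).row)⁻¹, k⟩ :=
        φ.apply_symm_apply _
      have hts : t * z = s := φ.injective <| by
        rw [map_mul]
        ext
        · simp [ht]
        · simp [ht]
        · simpa using hs
      refine .cons ⟨t, y, Or.inr (by rw [extendToOne_of, ← WithOne.coe_mul, hts])⟩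
        (ihM t (by rw [ht]) ?_)
      simp only [Prod.fst_mul, map_mul, hp', hw', ← hz] at hu
      rw [ht]
      simp only [mul_inv_rev, ← hu, inv_inv]
      group

theorem semigroupLoopProblem_eq_kleeneClosure
    (hw : ∀ y, σ (w y) = (φ (τ (FreeSemigroup.of y))).entry)
    (hw' : ∀ y, σ (w' y) = (φ (τ (FreeSemigroup.of y))).entry⁻¹)
    (hp : ∀ j i, σ (p j i) = P j i) (hp' : ∀ j i, σ (p' j i) = (P j i)⁻¹) :
    semigroupLoopProblem τ = kleeneClosure (transductionImage (wordProblem σ)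
      (coordinateTransducer τ φ w w' p p').accepted) := by
  apply Set.Subset.antisymm
  · rintro v ⟨_, rfl, h⟩
    exact (splits_of_loop_hasPath hw hw' hp hp' Submonoid.subset_closure h rfl).1 rfl
  · refine kleeneClosure_monoidLoopProblem_le _ ?_
    rintro v ⟨u, hu, _, rfl, h⟩
    exact ⟨1, rfl, (loop_hasPath_of_hasPath hw hw' hp hp' h rfl).1 rfl hu⟩

end LoopProblem

theorem mainTheorem4 {S : Type*} [Semigroup S] (hS : IsCompletelySimple S)
    {G : Type*} [Group G]
    (hG : ∃ H : Subsemigroup S, IsMaximalSubgroup H ∧ Nonempty (H ≃* G))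
    {Y : Type*} [Finite Y] (τ : FreeSemigroup Y →ₙ* S) (hτ : Function.Surjective τ) :
    Group.FG G ∧
    (∀ (X : Type*) [Finite X] (σ : FreeMonoid X →* G), Function.Surjective σ →
      ∃ ρ : Set (FreeMonoid X × FreeMonoid (Y ⊕ Y)), IsRationalTransduction ρ ∧
        semigroupLoopProblem τ = kleeneClosure (transductionImage (wordProblem σ) ρ)) ∧
    (∃ (m n : ℕ) (P : Fin n → Fin m → G), Nonempty (S ≃* ReesMatrix P)) ∧
    (∀ (X : Type*) [Finite X] (σ : FreeMonoid X →* G), Function.Surjective σ →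
      ∀ (I : Type*) (J : Type*) (P : J → I → G) (φ : S ≃* ReesMatrix P)
        (w w' : Y → FreeMonoid X) (p p' : J → I → FreeMonoid X),
        (∀ y, σ (w y) = (φ (τ (FreeSemigroup.of y))).entry) →
        (∀ y, σ (w' y) = (φ (τ (FreeSemigroup.of y))).entry⁻¹) →
        (∀ j i, σ (p j i) = P j i) →
        (∀ j i, σ (p' j i) = (P j i)⁻¹) →
        (reesTransducer (fun y => (φ (τ (FreeSemigroup.of y))).row)
            (fun y => (φ (τ (FreeSemigroup.of y))).col) w w' p p').IsFinite ∧
        semigroupLoopProblem τ = kleeneClosure (transductionImage (wordProblem σ)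
          (reesTransducer (fun y => (φ (τ (FreeSemigroup.of y))).row)
            (fun y => (φ (τ (FreeSemigroup.of y))).col) w w' p p').accepted)) := by
  have : Nonempty S := ⟨hS.1.choose⟩
  obtain ⟨m, n, P, ⟨φ⟩⟩ := hS.exists_finite_rees hG τ hτ
  refine ⟨groupFG_of_rees hτ φ, fun X _ σ hσ => ?_, ⟨m, n, P, ⟨φ⟩⟩,
    fun X _ σ _ I J P φ w w' p p' hw hw' hp hp' => ?_⟩
  · choose ν hν using hσ
    exact ⟨_, ⟨_, coordinateTransducer τ φ (fun y => ν (φ (τ (FreeSemigroup.of y))).entry)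
      (fun y => ν (φ (τ (FreeSemigroup.of y))).entry⁻¹) (fun j i => ν (P j i))
      (fun j i => ν (P j i)⁻¹), reesTransducer_isFinite _ _ _ _ _ _, rfl⟩,
      semigroupLoopProblem_eq_kleeneClosure (fun _ => hν _) (fun _ => hν _) (fun _ _ => hν _)
        (fun _ _ => hν _)⟩
  · have := finite_rows hτ φ
    have := finite_cols hτ φ
    exact ⟨reesTransducer_isFinite _ _ _ _ _ _,
      semigroupLoopProblem_eq_kleeneClosure hw hw' hp hp'⟩
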